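/- Let $F=\mathbb{R}$ or $F=\mathbb{C}$ and let $d\ge 0$ be an integer. Let $J=\begin{bmatrix}0&I_d\\-I_d&0\end{bmatrix}$ and let $\mathcal{SP}=\{H\in F^{2d\times 2d} : H^{T}JH=J\}$ be the group of symplectic matrices. Let $$\mathcal{T}=\left\{\begin{bmatrix}I&S\\0&I\end{bmatrix}\ \text{or}\ \begin{bmatrix}I&0\\S&I\end{bmatrix}\ :\ S\in F^{d\times d},\ S^{T}=S\right\}$$ be the set of unit triangular symplectic matrices, and for $n\ge 1$ let $\mathcal{L}_n=\{H_n\cdots H_2H_1 : H_i\in\mathcal{T},\ i=1,\dots,n\}$. Then $\mathcal{L}_4\subseteq\mathcal{L}_5=\mathcal{SP}$, and $\mathcal{L}_4$ is dense in $\mathcal{L}_5$, where $\mathcal{L}_5\subseteq F^{2d\times 2d}$ carries the subspace topology of the Euclidean topology. -/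

import Mathlib

namespace SymplecticFactorization

open Matrix

/-- The set `𝒯` of unit triangular symplectic matrices `[[I, S], [0, I]]` and `[[I, 0], [S, I]]`
with `S` a symmetric `d × d` matrix over `F`. -/
def unitTriangular (d : ℕ) (F : Type*) [Field F] : Set (Matrix (Fin d ⊕ Fin d) (Fin d ⊕ Fin d) F) :=
  {M | ∃ S : Matrix (Fin d) (Fin d) F, S.IsSymm ∧
    (M = fromBlocks 1 S 0 1 ∨ M = fromBlocks 1 0 S 1)}

/-- `ℒ_n`: the set of all products of exactly `n` unit triangular symplectic matrices (the factors
are listed from left to right). -/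
def triangularProducts (d : ℕ) (F : Type*) [Field F] (n : ℕ) :
    Set (Matrix (Fin d ⊕ Fin d) (Fin d ⊕ Fin d) F) :=
  {H | ∃ M : Fin n → Matrix (Fin d ⊕ Fin d) (Fin d ⊕ Fin d) F,
    (∀ i, M i ∈ unitTriangular d F) ∧ H = (List.ofFn M).prod}

/-- Mathlib's symplectic group is `{H | Hᵀ J H = J}` with `J = [[0, I], [-I, 0]]`. -/
theorem mem_symplecticGroup_iff (d : ℕ) (F : Type*) [Field F]
    (H : Matrix (Fin d ⊕ Fin d) (Fin d ⊕ Fin d) F) :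
    H ∈ symplecticGroup (Fin d) F ↔
      Hᵀ * fromBlocks 0 1 (-1) 0 * H = fromBlocks 0 1 (-1) 0 := by
  have hJ : (fromBlocks 0 1 (-1) 0 : Matrix (Fin d ⊕ Fin d) (Fin d ⊕ Fin d) F)
      = -J (Fin d) F := by
    simp [J, fromBlocks_neg]
  rw [SymplecticGroup.mem_iff', hJ]
  simp

end SymplecticFactorization

/-!
Write `U(S)` and `L(S)` for the upper and lower unit triangular matrices with off-diagonal block
`S`. By a theorem of Frobenius every square matrix over a field is a product of two symmetric
matrices: as a `K[X]`-module the space is a sum of quotients `K[X] / (q)`, and on each of these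
multiplication by `X` is self-adjoint for the form `(x, y) ↦ l (x * y)`, where `l` takes the top
coefficient of the reduced representative.

Let `H` be symplectic with invertible upper-left block `A`. Factoring `A - 1 = Q * S` gives a
symplectic matrix `U(Q) * L(S)` with the same upper-left block. By block LDU, two symplectic
matrices that share an invertible upper-left block differ only by a lower factor on the left and an
upper factor on the right, so `H = L(P) * U(Q) * L(S) * U(T)`.

For a general `H` with left blocks `A` and `C`, some symmetric `S` makes `A + S * C` invertible:
`U(S) * H` has four factors and `H` has five. Moreover `det (A + t • S * C)` is a nonzero
polynomial in `t`, hence nonzero for all small `t ≠ 0`, and `U(t • S) * H` tends to `H`.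
-/

namespace SymplecticFactorization

open Matrix Polynomial

section Symmetrizable

variable {R V W : Type*} [CommRing R] [AddCommGroup V] [Module R V] [AddCommGroup W] [Module R W]

/-- An endomorphism is symmetrizable if it is self-adjoint for some nondegenerate symmetric
bilinear form. In matrix terms `M * A` is symmetric for some symmetric nondegenerate `M`, and over
a field inverting `M` turns this into a factorization of `A` into two symmetric matrices. -/
def IsSymmetrizable (T : Module.End R V) : Prop :=
  ∃ B : LinearMap.BilinForm R V, B.IsSymm ∧ B.Nondegenerate ∧ B.IsSelfAdjoint T

theorem IsSymmetrizable.of_conj {T : Module.End R V} {T' : Module.End R W}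
    (h : IsSymmetrizable T') (e : V ≃ₗ[R] W) (he : ∀ v, e (T v) = T' (e v)) :
    IsSymmetrizable T := by
  obtain ⟨B, hsymm, hnondeg, hadj⟩ := h
  refine ⟨LinearMap.BilinForm.congr e.symm B, ⟨fun x y => hsymm.eq _ _⟩, hnondeg.congr e.symm,
    fun x y => ?_⟩
  simpa [he] using hadj (e x) (e y)

theorem IsSymmetrizable.piMap {ι : Type*} [Finite ι] {V : ι → Type*}
    [∀ i, AddCommGroup (V i)] [∀ i, Module R (V i)] {T : ∀ i, Module.End R (V i)}
    (h : ∀ i, IsSymmetrizable (T i)) : IsSymmetrizable (LinearMap.piMap T) := by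
  classical
  have := Fintype.ofFinite ι
  choose B hsymm hnondeg hadj using h
  let P : LinearMap.BilinForm R (∀ i, V i) :=
    ∑ i, (B i).compl₁₂ (LinearMap.proj i) (LinearMap.proj i)
  have hP (x y : ∀ i, V i) : P x y = ∑ i, B i (x i) (y i) := by simp [P, LinearMap.sum_apply]
  have hPsymm : P.IsSymm := ⟨fun x y => by simp only [hP, (hsymm _).eq (y _)]⟩
  have hPsingle (x : ∀ i, V i) (i : ι) (y : V i) : P x (Pi.single i y) = B i (x i) y := by
    rw [hP, Finset.sum_eq_single_of_mem i (Finset.mem_univ i), Pi.single_eq_same]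
    intro j _ hj
    rw [Pi.single_eq_of_ne hj, map_zero]
  refine ⟨P, hPsymm, hPsymm.isRefl.nondegenerate_iff_separatingLeft.2 fun x hx => ?_,
    fun x y => ?_⟩
  · ext i
    exact (hnondeg i).1 (x i) fun y => by rw [← hPsingle, hx]
  · simp only [hP, LinearMap.coe_piMap, Pi.map_apply, hadj _ _ _]

theorem isSymmetrizable_mulLeft {S : Type*} [CommRing S] [Algebra R S] {l : S →ₗ[R] R}
    (hl : ∀ x, (∀ y, l (x * y) = 0) → x = 0) (a : S) :
    IsSymmetrizable (LinearMap.mulLeft R a) := by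
  have hsymm : LinearMap.BilinForm.IsSymm ((LinearMap.mul R S).compr₂ l) :=
    ⟨fun x y => by simp [mul_comm]⟩
  exact ⟨_, hsymm, hsymm.isRefl.nondegenerate_iff_separatingLeft.2 hl,
    fun x y => by simp [mul_assoc, mul_left_comm]⟩

/-- The functional is the coefficient of `X ^ (deg g - 1)` of the reduced representative: a
nonzero remainder is shifted into that degree by a suitable power of `X`. -/
theorem exists_separating_functional_adjoinRoot {g : R[X]} (hg : g.Monic) :
    ∃ l : AdjoinRoot g →ₗ[R] R, ∀ x, (∀ y, l (x * y) = 0) → x = 0 := by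
  rcases subsingleton_or_nontrivial R
  · have := Module.subsingleton R (AdjoinRoot g)
    exact ⟨0, fun x _ => Subsingleton.elim x 0⟩
  refine ⟨lcoeff R (g.natDegree - 1) ∘ₗ AdjoinRoot.modByMonicHom hg, fun x hx => ?_⟩
  obtain ⟨r, rfl, hr⟩ : ∃ r, AdjoinRoot.mk g r = x ∧ r.degree < g.degree := by
    obtain ⟨p, rfl⟩ := AdjoinRoot.mk_surjective x
    refine ⟨p %ₘ g, ?_, degree_modByMonic_lt p hg⟩
    simpa using AdjoinRoot.mk_leftInverse hg (AdjoinRoot.mk g p)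
  by_contra hne
  have hr0 : r ≠ 0 := by
    rintro rfl
    exact hne (map_zero _)
  have hdeg : r.natDegree < g.natDegree := natDegree_lt_natDegree hr0 hr
  obtain ⟨k, hk⟩ := Nat.exists_eq_add_of_lt hdeg
  have hshift : (r * X ^ k) %ₘ g = r * X ^ k := by
    refine (modByMonic_eq_self_iff hg).2 (degree_lt_degree ?_)
    rw [natDegree_mul_X_pow k hr0]
    lia
  have hcoeff := hx (AdjoinRoot.mk g (X ^ k))
  rw [← map_mul, LinearMap.comp_apply, AdjoinRoot.modByMonicHom_mk, hshift, lcoeff_apply,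
    hk, Nat.add_sub_cancel, coeff_mul_X_pow] at hcoeff
  exact hr0 (leadingCoeff_eq_zero.1 hcoeff)

end Symmetrizable

section Frobenius

variable {K : Type*} [Field K]

theorem isSymmetrizable_mulLeft_quotient_span {q : K[X]} (hq : q ≠ 0)
    (a : K[X] ⧸ Ideal.span {q}) : IsSymmetrizable (LinearMap.mulLeft K a) := by
  have hunit : IsUnit (C q.leadingCoeff⁻¹) := by simpa using hq
  revert a
  rw [← Ideal.span_singleton_mul_right_unit hunit q]
  obtain ⟨l, hl⟩ := exists_separating_functional_adjoinRoot (monic_mul_leadingCoeff_inv hq)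
  exact isSymmetrizable_mulLeft hl

theorem isSymmetrizable {V : Type*} [AddCommGroup V] [Module K V] [FiniteDimensional K V]
    (T : Module.End K V) : IsSymmetrizable T := by
  obtain ⟨ι, _, p, hp, e, ⟨φ⟩⟩ :=
    Module.equiv_directSum_of_isTorsion (Module.AEval.isTorsion_of_finiteDimensional K V T)
  let ψ := Module.AEval'.of T ≪≫ₗ φ.restrictScalars K ≪≫ₗ DirectSum.linearEquivFunOnFintype K _ _
  refine (IsSymmetrizable.piMap fun i => isSymmetrizable_mulLeft_quotient_span
    (pow_ne_zero (e i) (hp i).ne_zero) (Ideal.Quotient.mk _ X)).of_conj ψ fun v => ?_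
  have hφ : φ (Module.AEval'.of T (T v)) = (X : K[X]) • φ (Module.AEval'.of T v) := by
    rw [← map_smul, Module.AEval'.X_smul_of]
  ext i
  exact DFunLike.congr_fun hφ i

theorem exists_isSymm_mul_isSymm {n : Type*} [Fintype n] (A : Matrix n n K) :
    ∃ Q R : Matrix n n K, Q.IsSymm ∧ R.IsSymm ∧ A = Q * R := by
  classical
  obtain ⟨B, hsymm, hnondeg, hadj⟩ := isSymmetrizable (toLin' A)
  set M := LinearMap.BilinForm.toMatrix' B with hM
  have hMsymm : M.IsSymm := LinearMap.BilinForm.isSymm_toMatrix'_iff_isSymm.2 hsymm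
  have hMdet : IsUnit M.det :=
    (nondegenerate_iff_det_ne_zero.1 (LinearMap.BilinForm.Nondegenerate.toMatrix' hnondeg)).isUnit
  have hMA : Aᵀ * M = M * A := by
    rw [← Matrix.toBilin'_toMatrix' B] at hadj
    exact (isAdjointPair_toLinearMap₂' M M A A).1 hadj
  refine ⟨M⁻¹, M * A, hMsymm.inv, ?_, (nonsing_inv_mul_cancel_left _ _ hMdet).symm⟩
  rw [IsSymm, transpose_mul, hMsymm.eq, hMA]

end Frobenius

section Shear

variable {n : Type*} [Fintype n] [DecidableEq n]

theorem ker_add_single_mul_lt {R : Type*} [CommRing R] [NoZeroDivisors R] {A C : Matrix n n R}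
    (hAC : (Aᵀ * C).IsSymm) {v : n → R} (hAv : A *ᵥ v = 0) {i : n} (hCv : (C *ᵥ v) i ≠ 0) :
    LinearMap.ker (A + single i i 1 * C).mulVecLin < LinearMap.ker A.mulVecLin := by
  have hsingle (x : n → R) : (single i i 1 * C) *ᵥ x = Pi.single i ((C *ᵥ x) i) := by
    rw [← mulVec_mulVec, single_mulVec, one_mul]; rfl
  -- `Aᵀ * C` is symmetric, so `A *ᵥ v = 0` makes `C *ᵥ v` orthogonal to the range of `A`;
  -- pairing with `C *ᵥ v` thus isolates the contribution of the rank-one shear.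
  have hortho (x : n → R) : (C *ᵥ v) ⬝ᵥ (A *ᵥ x) = 0 := by
    have hCA : Cᵀ * A = Aᵀ * C := by simpa [IsSymm, transpose_mul] using hAC
    rw [← vecMul_transpose, ← dotProduct_mulVec, mulVec_mulVec, hCA, ← mulVec_mulVec,
      dotProduct_mulVec, vecMul_transpose, hAv, zero_dotProduct]
  have hker {x : n → R} (hx : (A + single i i 1 * C) *ᵥ x = 0) : (C *ᵥ x) i = 0 := by
    have := congrArg ((C *ᵥ v) ⬝ᵥ ·) hx
    simpa [add_mulVec, hsingle, hortho, hCv] using this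
  refine SetLike.lt_iff_le_and_exists.2 ⟨fun x hx => ?_, v, hAv, fun hv => hCv (hker hv)⟩
  have hx' : (A + single i i 1 * C) *ᵥ x = 0 := hx
  simpa [add_mulVec, hsingle, hker hx'] using hx'

theorem exists_det_add_diagonal_mul_ne_zero {K : Type*} [Field K] {A C : Matrix n n K}
    (hAC : (Aᵀ * C).IsSymm)
    (hker : Disjoint (LinearMap.ker A.mulVecLin) (LinearMap.ker C.mulVecLin)) :
    ∃ s : n → K, (A + diagonal s * C).det ≠ 0 := by
  induction hN : LinearMap.ker A.mulVecLin using WellFoundedLT.induction generalizing A with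
  | _ N ih =>
  subst hN
  by_cases hA : A.det = 0
  swap
  · exact ⟨0, by simpa using hA⟩
  obtain ⟨v, hv, hAv⟩ := exists_mulVec_eq_zero_iff.2 hA
  obtain ⟨i, hi⟩ : ∃ i, (C *ᵥ v) i ≠ 0 :=
    Function.ne_iff.1 fun hCv => hv (Submodule.disjoint_def.1 hker v hAv hCv)
  have hlt := ker_add_single_mul_lt hAC hAv hi
  have hsymm : ((A + single i i 1 * C)ᵀ * C).IsSymm := by
    rw [transpose_add, Matrix.add_mul, transpose_mul, transpose_single]
    exact hAC.add (by simp [IsSymm, transpose_mul, Matrix.mul_assoc])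
  obtain ⟨s, hs⟩ := ih _ hlt hsymm (hker.mono_left hlt.le) rfl
  refine ⟨Pi.single i 1 + s, ?_⟩
  have hdiag : diagonal (Pi.single i 1 + s) = single i i 1 + diagonal s := by
    rw [← diagonal_single, diagonal_add]; rfl
  rwa [hdiag, Matrix.add_mul, ← add_assoc]

end Shear

theorem finite_setOf_det_add_smul_eq_zero {R n : Type*} [CommRing R] [IsDomain R] [Fintype n]
    [DecidableEq n] {A M : Matrix n n R} {t₀ : R} (h : (A + t₀ • M).det ≠ 0) :
    {t : R | (A + t • M).det = 0}.Finite := by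
  let P : R[X] := (A.map C + (X : R[X]) • M.map C).det
  have heval (t : R) : P.eval t = (A + t • M).det := by
    rw [← coe_evalRingHom, RingHom.map_det]
    congr 1
    ext i j
    simp only [RingHom.mapMatrix_apply, map_apply, Matrix.add_apply, Matrix.smul_apply,
      smul_eq_mul, coe_evalRingHom, eval_add, eval_mul, eval_C, eval_X]
  have hP : P ≠ 0 := fun hP => h (by rw [← heval, hP, eval_zero])
  simpa only [IsRoot.def, heval] using finite_setOfPred_isRoot hP

section Symplectic

variable {l R : Type*} [Fintype l] [DecidableEq l] [CommRing R]
  {A B C D B' C' D' : Matrix l l R}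

theorem isSymm_mul_inv_of_mem_symplecticGroup (h : fromBlocks A B C D ∈ symplecticGroup l R)
    (hA : IsUnit A.det) : (C * A⁻¹).IsSymm := by
  have hAC := (SymplecticGroup.fromBlocks_mem_iff.1 h).1
  have hAt : IsUnit Aᵀ.det := by rwa [det_transpose]
  calc (C * A⁻¹)ᵀ = Aᵀ⁻¹ * (Cᵀ * A) * A⁻¹ := by
        rw [transpose_mul, transpose_nonsing_inv, Matrix.mul_assoc,
          mul_nonsing_inv_cancel_right _ _ hA]
    _ = C * A⁻¹ := by rw [← hAC, nonsing_inv_mul_cancel_left _ _ hAt]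

theorem isSymm_inv_mul_of_mem_symplecticGroup (h : fromBlocks A B C D ∈ symplecticGroup l R)
    (hA : IsUnit A.det) : (A⁻¹ * B).IsSymm := by
  have ht := SymplecticGroup.transpose_mem h
  rw [fromBlocks_transpose] at ht
  have := isSymm_mul_inv_of_mem_symplecticGroup ht (by rwa [det_transpose])
  rwa [← transpose_nonsing_inv, ← transpose_mul, isSymm_transpose_iff] at this

theorem sub_mul_inv_mul_eq_of_mem_symplecticGroup (h : fromBlocks A B C D ∈ symplecticGroup l R)
    (hA : IsUnit A.det) : D - C * A⁻¹ * B = Aᵀ⁻¹ := by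
  have hAt : IsUnit Aᵀ.det := by rwa [det_transpose]
  calc D - C * A⁻¹ * B = Aᵀ⁻¹ * (Aᵀ * D - Cᵀ * B) := by
        rw [← (isSymm_mul_inv_of_mem_symplecticGroup h hA).eq, transpose_mul,
          transpose_nonsing_inv, Matrix.mul_sub, nonsing_inv_mul_cancel_left _ _ hAt,
          Matrix.mul_assoc]
    _ = Aᵀ⁻¹ := by rw [(SymplecticGroup.fromBlocks_mem_iff.1 h).2.2, Matrix.mul_one]

theorem fromBlocks_eq_of_mem_symplecticGroup (h : fromBlocks A B C D ∈ symplecticGroup l R)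
    (hA : IsUnit A.det) :
    fromBlocks A B C D =
      fromBlocks 1 0 (C * A⁻¹) 1 * fromBlocks A 0 0 Aᵀ⁻¹ * fromBlocks 1 (A⁻¹ * B) 0 1 := by
  let _ := invertibleOfIsUnitDet A hA
  rw [fromBlocks_eq_of_invertible₁₁ A B C D, invOf_eq_nonsing_inv,
    sub_mul_inv_mul_eq_of_mem_symplecticGroup h hA]

theorem fromBlocks_eq_lower_mul_mul_upper (h : fromBlocks A B C D ∈ symplecticGroup l R)
    (h' : fromBlocks A B' C' D' ∈ symplecticGroup l R) (hA : IsUnit A.det) :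
    fromBlocks A B C D =
      fromBlocks 1 0 (C * A⁻¹ - C' * A⁻¹) 1 * fromBlocks A B' C' D' *
        fromBlocks 1 (A⁻¹ * B - A⁻¹ * B') 0 1 := by
  have hlower : (fromBlocks 1 0 (C * A⁻¹ - C' * A⁻¹) 1 * fromBlocks 1 0 (C' * A⁻¹) 1 :
      Matrix (l ⊕ l) (l ⊕ l) R) = fromBlocks 1 0 (C * A⁻¹) 1 := by
    simp [fromBlocks_multiply]
  have hupper : (fromBlocks 1 (A⁻¹ * B') 0 1 * fromBlocks 1 (A⁻¹ * B - A⁻¹ * B') 0 1 :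
      Matrix (l ⊕ l) (l ⊕ l) R) = fromBlocks 1 (A⁻¹ * B) 0 1 := by
    simp [fromBlocks_multiply]
  rw [fromBlocks_eq_of_mem_symplecticGroup h hA, fromBlocks_eq_of_mem_symplecticGroup h' hA,
    ← hlower, ← hupper]
  simp only [Matrix.mul_assoc]

theorem upper_mem_symplecticGroup {S : Matrix l l R} (hS : S.IsSymm) :
    fromBlocks 1 S 0 1 ∈ symplecticGroup l R := by
  simp [SymplecticGroup.fromBlocks_mem_iff, hS.eq]

theorem lower_mem_symplecticGroup {S : Matrix l l R} (hS : S.IsSymm) :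
    fromBlocks 1 0 S 1 ∈ symplecticGroup l R := by
  simp [SymplecticGroup.fromBlocks_mem_iff, hS.eq]

theorem disjoint_ker_toBlocks_of_isUnit_det {H : Matrix (l ⊕ l) (l ⊕ l) R} (hH : IsUnit H.det) :
    Disjoint (LinearMap.ker H.toBlocks₁₁.mulVecLin) (LinearMap.ker H.toBlocks₂₁.mulVecLin) := by
  refine Submodule.disjoint_def.2 fun v (hA : H.toBlocks₁₁ *ᵥ v = 0)
    (hC : H.toBlocks₂₁ *ᵥ v = 0) => ?_
  have hHv : H *ᵥ Sum.elim v 0 = H *ᵥ 0 := by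
    rw [← fromBlocks_toBlocks H, fromBlocks_mulVec]
    simp [hA, hC]
  have hv := mulVec_injective_of_isUnit ((isUnit_iff_isUnit_det H).2 hH) hHv
  exact funext fun i => congrFun hv (Sum.inl i)

theorem toBlocks₁₁_upper_mul (S : Matrix l l R) (H : Matrix (l ⊕ l) (l ⊕ l) R) :
    (fromBlocks 1 S 0 1 * H).toBlocks₁₁ = H.toBlocks₁₁ + S * H.toBlocks₂₁ := by
  rw [← fromBlocks_toBlocks H, fromBlocks_multiply]
  simp

theorem exists_isSymm_det_add_mul_ne_zero {K : Type*} [Field K] {H : Matrix (l ⊕ l) (l ⊕ l) K}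
    (hH : H ∈ symplecticGroup l K) :
    ∃ S : Matrix l l K, S.IsSymm ∧ (H.toBlocks₁₁ + S * H.toBlocks₂₁).det ≠ 0 := by
  have hblocks := hH
  rw [← fromBlocks_toBlocks H, SymplecticGroup.fromBlocks_mem_iff] at hblocks
  have hsymm : (H.toBlocks₁₁ᵀ * H.toBlocks₂₁).IsSymm := by
    rw [IsSymm, transpose_mul, transpose_transpose, hblocks.1]
  obtain ⟨s, hs⟩ := exists_det_add_diagonal_mul_ne_zero hsymm
    (disjoint_ker_toBlocks_of_isUnit_det (SymplecticGroup.symplectic_det hH))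
  exact ⟨diagonal s, isSymm_diagonal s, hs⟩

theorem exists_eq_lower_mul_upper_mul_lower_mul_upper {K : Type*} [Field K]
    {H : Matrix (l ⊕ l) (l ⊕ l) K} (hH : H ∈ symplecticGroup l K) (hdet : H.toBlocks₁₁.det ≠ 0) :
    ∃ P Q S T : Matrix l l K, P.IsSymm ∧ Q.IsSymm ∧ S.IsSymm ∧ T.IsSymm ∧
      H = fromBlocks 1 0 P 1 * fromBlocks 1 Q 0 1 * fromBlocks 1 0 S 1 * fromBlocks 1 T 0 1 := by
  obtain ⟨A, B, C, D, rfl⟩ : ∃ A B C D, H = fromBlocks A B C D :=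
    ⟨_, _, _, _, (fromBlocks_toBlocks H).symm⟩
  have hA : IsUnit A.det := by simpa using hdet
  obtain ⟨Q, S, hQ, hS, hQS⟩ := exists_isSymm_mul_isSymm (A - 1)
  have hmiddle : fromBlocks 1 Q 0 1 * fromBlocks 1 0 S 1 = fromBlocks A Q S 1 := by
    simp [fromBlocks_multiply, ← hQS]
  have hN : fromBlocks A Q S 1 ∈ symplecticGroup l K :=
    hmiddle ▸ mul_mem (upper_mem_symplecticGroup hQ) (lower_mem_symplecticGroup hS)
  refine ⟨C * A⁻¹ - S * A⁻¹, Q, S, A⁻¹ * B - A⁻¹ * Q,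
    (isSymm_mul_inv_of_mem_symplecticGroup hH hA).sub (isSymm_mul_inv_of_mem_symplecticGroup hN hA),
    hQ, hS,
    (isSymm_inv_mul_of_mem_symplecticGroup hH hA).sub (isSymm_inv_mul_of_mem_symplecticGroup hN hA),
    ?_⟩
  rw [Matrix.mul_assoc (fromBlocks 1 0 (C * A⁻¹ - S * A⁻¹) 1), hmiddle]
  exact fromBlocks_eq_lower_mul_mul_upper hH hN hA

end Symplectic

section Products

open scoped Pointwise

variable {d : ℕ} {K : Type*} [Field K] {S : Matrix (Fin d) (Fin d) K}
  {H : Matrix (Fin d ⊕ Fin d) (Fin d ⊕ Fin d) K}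

theorem triangularProducts_eq_pow (n : ℕ) : triangularProducts d K n = unitTriangular d K ^ n := by
  ext H
  rw [Set.mem_pow]
  constructor
  · rintro ⟨M, hM, rfl⟩
    exact ⟨fun i => ⟨M i, hM i⟩, rfl⟩
  · rintro ⟨M, rfl⟩
    exact ⟨fun i => M i, fun i => (M i).2, rfl⟩

theorem upper_mem_unitTriangular (hS : S.IsSymm) : fromBlocks 1 S 0 1 ∈ unitTriangular d K :=
  ⟨S, hS, .inl rfl⟩

theorem lower_mem_unitTriangular (hS : S.IsSymm) : fromBlocks 1 0 S 1 ∈ unitTriangular d K :=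
  ⟨S, hS, .inr rfl⟩

theorem one_mem_unitTriangular : 1 ∈ unitTriangular d K :=
  ⟨0, isSymm_zero, .inl fromBlocks_one.symm⟩

theorem unitTriangular_subset_symplecticGroup :
    unitTriangular d K ⊆ symplecticGroup (Fin d) K := by
  rintro _ ⟨S, hS, rfl | rfl⟩
  exacts [upper_mem_symplecticGroup hS, lower_mem_symplecticGroup hS]

theorem triangularProducts_subset_symplecticGroup (n : ℕ) :
    triangularProducts d K n ⊆ symplecticGroup (Fin d) K := by
  rw [triangularProducts_eq_pow]
  exact Submonoid.pow_subset unitTriangular_subset_symplecticGroup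

theorem triangularProducts_mono : Monotone (triangularProducts d K) := fun m n hmn => by
  simp only [triangularProducts_eq_pow]
  exact Set.pow_subset_pow_right one_mem_unitTriangular hmn

theorem mem_triangularProducts_four (hH : H ∈ symplecticGroup (Fin d) K)
    (hdet : H.toBlocks₁₁.det ≠ 0) : H ∈ triangularProducts d K 4 := by
  obtain ⟨P, Q, S, T, hP, hQ, hS, hT, rfl⟩ := exists_eq_lower_mul_upper_mul_lower_mul_upper hH hdet
  rw [triangularProducts_eq_pow]
  simp only [pow_succ, pow_zero, one_mul]
  exact Set.mul_mem_mul (Set.mul_mem_mul (Set.mul_mem_mul (lower_mem_unitTriangular hP)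
    (upper_mem_unitTriangular hQ)) (lower_mem_unitTriangular hS)) (upper_mem_unitTriangular hT)

theorem triangularProducts_five_eq_symplecticGroup :
    triangularProducts d K 5 = symplecticGroup (Fin d) K := by
  refine (triangularProducts_subset_symplecticGroup 5).antisymm fun H hH => ?_
  obtain ⟨S, hS, hdet⟩ := exists_isSymm_det_add_mul_ne_zero hH
  have hshear := mem_triangularProducts_four
    (mul_mem (upper_mem_symplecticGroup hS) hH) (by rwa [toBlocks₁₁_upper_mul])
  have hH_eq : H = fromBlocks 1 (-S) 0 1 * (fromBlocks 1 S 0 1 * H) := by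
    simp [← Matrix.mul_assoc, fromBlocks_multiply]
  rw [triangularProducts_eq_pow] at hshear ⊢
  rw [hH_eq, pow_succ']
  exact Set.mul_mem_mul (upper_mem_unitTriangular hS.neg) hshear

open scoped Topology in
theorem symplecticGroup_subset_closure_triangularProducts_four [TopologicalSpace K]
    [IsTopologicalRing K] [T1Space K] [(𝓝[≠] (0 : K)).NeBot] :
    (symplecticGroup (Fin d) K : Set _) ⊆ closure (triangularProducts d K 4) := by
  intro H hH
  obtain ⟨S, hS, hdet⟩ := exists_isSymm_det_add_mul_ne_zero hH
  have htendsto : Filter.Tendsto (fun t : K => fromBlocks 1 (t • S) 0 1 * H) (𝓝[≠] 0) (𝓝 H) := by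
    have hcont : Continuous fun t : K => fromBlocks 1 (t • S) 0 1 * H := by fun_prop
    simpa using (hcont.tendsto 0).mono_left nhdsWithin_le_nhds
  have hfinite : {t : K | (H.toBlocks₁₁ + t • (S * H.toBlocks₂₁)).det = 0}.Finite :=
    finite_setOf_det_add_smul_eq_zero (t₀ := 1) (by rwa [one_smul])
  refine mem_closure_of_tendsto htendsto ?_
  filter_upwards [nhdsNE_le_cofinite 0 hfinite.compl_mem_cofinite] with t ht
  refine mem_triangularProducts_four (mul_mem (upper_mem_symplecticGroup (hS.smul t)) hH) ?_
  rwa [toBlocks₁₁_upper_mul, Matrix.smul_mul]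

end Products

end SymplecticFactorization

open scoped Topology in
theorem mainTheorem4_general {F : Type*} [Field F] [TopologicalSpace F] [IsTopologicalRing F]
    [T1Space F] [(𝓝[≠] (0 : F)).NeBot] (d : ℕ) :
    SymplecticFactorization.triangularProducts d F 5 =
        (Matrix.symplecticGroup (Fin d) F :
          Set (Matrix (Fin d ⊕ Fin d) (Fin d ⊕ Fin d) F)) ∧
      SymplecticFactorization.triangularProducts d F 4 ⊆
        SymplecticFactorization.triangularProducts d F 5 ∧
      Dense {H : SymplecticFactorization.triangularProducts d F 5 |
        (H : Matrix (Fin d ⊕ Fin d) (Fin d ⊕ Fin d) F) ∈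
          SymplecticFactorization.triangularProducts d F 4} := by
  open SymplecticFactorization in
  have hsubset : triangularProducts d F 4 ⊆ triangularProducts d F 5 :=
    triangularProducts_mono (Nat.le_succ 4)
  refine ⟨triangularProducts_five_eq_symplecticGroup, hsubset, Subtype.dense_iff.2 ?_⟩
  have himage : ((↑) '' {H : triangularProducts d F 5 | ↑H ∈ triangularProducts d F 4} :
      Set (Matrix (Fin d ⊕ Fin d) (Fin d ⊕ Fin d) F)) = triangularProducts d F 4 :=
    (Subtype.image_preimage_coe _ _).trans (Set.inter_eq_right.2 hsubset)
  rw [himage, triangularProducts_five_eq_symplecticGroup]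
  exact symplecticGroup_subset_closure_triangularProducts_four

theorem mainTheorem4 {F : Type*} [RCLike F] (d : ℕ) :
    SymplecticFactorization.triangularProducts d F 5 =
        (Matrix.symplecticGroup (Fin d) F :
          Set (Matrix (Fin d ⊕ Fin d) (Fin d ⊕ Fin d) F)) ∧
      SymplecticFactorization.triangularProducts d F 4 ⊆
        SymplecticFactorization.triangularProducts d F 5 ∧
      Dense {H : SymplecticFactorization.triangularProducts d F 5 |
        (H : Matrix (Fin d ⊕ Fin d) (Fin d ⊕ Fin d) F) ∈
          SymplecticFactorization.triangularProducts d F 4} :=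
  mainTheorem4_general d
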